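/- Let $d\ge 1$ be an integer, let $A\subset\mathbb{R}^d$ be compact, let $B\subset\mathbb{R}^d$ be a non-empty open set, let $m>0$ be an integer, $\gamma>0$ a real number and $0\le\mu<m$. Write $$\mathcal F v(\xi)=\frac{1}{(2\pi)^d}\int_{\mathbb{R}^d}e^{i\xi x}v(x)\,dx,\qquad |v|_{H^m(\mathbb{R}^d)}=\Big(\sum_{j=1}^d\Big\|\frac{\partial^m v}{(\partial x_j)^m}\Big\|_{L^2(\mathbb{R}^d)}^2\Big)^{1/2},$$ where $v$ belongs to the Sobolev space $H^m(\mathbb{R}^d)$ of complex-valued functions in $L^2(\mathbb{R}^d)$ whose weak derivatives up to order $m$ are in $L^2(\mathbb{R}^d)$. Then there is a constant $c=c(A,B,\gamma,\mu,m)>0$ such that every $v\in H^m(\mathbb{R}^d)$, $v:\mathbb{R}^d\to\mathbb{C}$, that is supported in $A$ and satisfies $|v|_{H^m(\mathbb{R}^d)}\le\gamma$ and $\|\mathcal F v\|_{L^\infty(B)}<1$ also satisfies $$\|v\|_{L^2(\mathbb{R}^d)}\le c\,\Big(\ln\frac{1}{\|\mathcal F v\|_{L^\infty(B)}}\Big)^{-\mu}.$$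 (If $\|\mathcal F v\|_{L^\infty(B)}=0$, the last factor is read as $0$ for $\mu>0$ and as $1$ for $\mu=0$.) -/

import Mathlib

open MeasureTheory TemperedDistribution
open scoped ENNReal SchwartzMap LineDeriv

namespace FourierStability

/-- The Euclidean space `ℝ^d`. -/
abbrev Space (d : ℕ) : Type := EuclideanSpace ℝ (Fin d)

/-- The Fourier transform `𝓕 v (ξ) = (2π)^{-d} ∫ e^{i ξ·x} v(x) dx`. -/
noncomputable def fourierTransform {d : ℕ} (v : Space d → ℂ) (ξ : Space d) : ℂ :=
  (((2 * Real.pi) ^ d : ℝ) : ℂ)⁻¹ *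
    ∫ x, Complex.exp (Complex.I * ((inner ℝ ξ x : ℝ) : ℂ)) * v x

/-- The `L²` norm of a tempered distribution: `‖g‖` if the distribution is given by
`g ∈ L²` (such a `g` is unique), and `∞` if it is not given by an `L²` function. -/
noncomputable def l2Norm {d : ℕ} (T : 𝓢'(Space d, ℂ)) : ℝ≥0∞ :=
  ⨅ (g : Lp ℂ 2 (volume : Measure (Space d))) (_ : T = (g : 𝓢'(Space d, ℂ))), ‖g‖ₑ

/-- On `L²` functions `l2Norm` is the usual norm. -/
theorem l2Norm_coe {d : ℕ} (g : Lp ℂ 2 (volume : Measure (Space d))) :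
    l2Norm (g : 𝓢'(Space d, ℂ)) = ‖g‖ₑ := by
  refine le_antisymm (iInf_le_of_le g (iInf_le _ rfl)) (le_iInf₂ fun g' h => ?_)
  have hinj := LinearMap.ker_eq_bot.mp
    (Lp.ker_toTemperedDistributionCLM_eq_bot (F := ℂ) (μ := (volume : Measure (Space d))) (p := 2))
  have : g = g' := hinj h
  rw [this]

/-- The seminorm `|T|_{H^m} = (∑_j ‖∂^m T / (∂ x_j)^m‖_{L²}²)^{1/2}`, where the derivatives are
taken in the sense of distributions. -/
noncomputable def sobolevSeminorm {d : ℕ} (m : ℕ) (T : 𝓢'(Space d, ℂ)) : ℝ≥0∞ :=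
  (∑ j : Fin d,
    l2Norm (∂^{fun _ : Fin m => (EuclideanSpace.single j (1 : ℝ) : Space d)} T) ^ 2) ^ (1 / 2 : ℝ)

/-- The essential supremum norm `‖𝓕 v‖_{L^∞(B)}`. -/
noncomputable def fourierSupNorm {d : ℕ} (B : Set (Space d)) (v : Space d → ℂ) : ℝ≥0∞ :=
  eLpNorm (fourierTransform v) ∞ (volume.restrict B)

end FourierStability

namespace FourierStability

open scoped FourierTransform Nat

/-! A function supported in a ball has an entire Fourier transform of exponential type, so smallness
on one ball propagates. The quantitative form here is Newton extrapolation. With z = e^{-2πi x·w/N},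
the value 𝓕v(ξ+w) is the integral of z^N = (1 + (z-1))^N against e^{-2πi x·ξ} v(x). The binomial
terms of degree below n are finite differences of 𝓕v at points of the ball around ξ; the rest is at
most e^{2πea‖w‖ - n} for ‖x‖ ≤ a (`norm_fourier_le_of_forall_ball`).

For frequencies up to a small multiple of n the remainder is O(e^{-n/2}), while the data error is
amplified by a factor n^{O(n)}. Data of size exp(-(n/2)^β) with β > 1 beat this factor. By
Plancherel, the seminorm bounds the contribution of higher frequencies to the L² norm by O(n^{-m})
(`eLpNorm_sq_le_of_norm_fourier_le`). Hence ‖v‖ ≤ c n^{-m} (`exists_eLpNorm_le_div_pow`), where the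
L¹ norm in the remainder is controlled by Poincaré's inequality (`exists_eLpNorm_le`).

For data of size e^{-L}, taking β = m/μ and n ≈ L^{μ/m} turns n^{-m} into L^{-μ}. The condition μ <
m is what makes β > 1. -/

/-! ### Truncated binomial expansion -/

/-- Truncation error of the binomial expansion of `z ^ N` around `1`. -/
theorem norm_pow_sub_sum_choose_le (z : ℂ) {N : ℕ} (hN : 0 < N) (n : ℕ) {t : ℝ}
    (hz : ‖z - 1‖ ≤ t / N) :
    ‖z ^ N - ∑ k ∈ Finset.range n, (N.choose k : ℂ) * (z - 1) ^ k‖ ≤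
      Real.exp (Real.exp 1 * t - n) := by
  have hN' : (0 : ℝ) < N := by exact_mod_cast hN
  have ht : 0 ≤ t := by
    by_contra h
    have := div_neg_of_neg_of_pos (not_le.mp h) hN'
    linarith [norm_nonneg (z - 1)]
  -- The sum runs past N, where the binomial coefficients vanish, so that n terms can be split off
  -- even when n > N.
  have hexp : z ^ N = ∑ k ∈ Finset.range (N + 1 + n), (N.choose k : ℂ) * (z - 1) ^ k := by
    have h1 : z ^ N = ((z - 1) + 1) ^ N := by ring
    rw [h1, add_pow, Finset.sum_range_add (m := n)]
    have : ∑ x ∈ Finset.range n, (N.choose (N + 1 + x) : ℂ) * (z - 1) ^ (N + 1 + x) = 0 := by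
      refine Finset.sum_eq_zero fun x _ => ?_
      rw [Nat.choose_eq_zero_of_lt (by omega)]
      simp
    rw [this, add_zero]
    exact Finset.sum_congr rfl fun k _ => by ring
  have hterm : ∀ k, ‖(N.choose k : ℂ) * (z - 1) ^ k‖ ≤ t ^ k / k ! := fun k => by
    rw [norm_mul, norm_pow, Complex.norm_natCast]
    calc (N.choose k : ℝ) * ‖z - 1‖ ^ k ≤ ((N : ℝ) ^ k / k !) * (t / N) ^ k := by
          gcongr
          exact Nat.choose_le_pow_div k N
      _ = t ^ k / k ! := by
          rw [div_pow]; field_simp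
  rw [hexp, add_comm (N + 1) n, Finset.sum_range_add, add_sub_cancel_left]
  calc _ ≤ ∑ x ∈ Finset.range (N + 1), t ^ (n + x) / (n + x)! :=
        norm_sum_le_of_le _ fun k _ => hterm _
    -- Replacing t by e·t gains e^{n+x} ≥ e^n in each tail term, which pays for the factor e^{-n}.
    _ ≤ ∑ x ∈ Finset.range (N + 1),
          Real.exp (-n) * ((Real.exp 1 * t) ^ (n + x) / (n + x)!) := by
        refine Finset.sum_le_sum fun x _ => ?_
        rw [mul_pow, ← Real.exp_nat_mul, mul_one, mul_div_assoc, ← mul_assoc, ← Real.exp_add]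
        refine le_mul_of_one_le_left (by positivity) (Real.one_le_exp ?_)
        push_cast
        linarith [Nat.cast_nonneg (α := ℝ) x]
    _ = Real.exp (-n) * ∑ x ∈ Finset.range (N + 1), ((Real.exp 1 * t) ^ (n + x) / (n + x)!) := by
        rw [Finset.mul_sum]
    _ ≤ Real.exp (-n) * ∑ x ∈ Finset.range (n + (N + 1)), ((Real.exp 1 * t) ^ x / x !) := by
        gcongr
        rw [Finset.sum_range_add _ n]
        exact le_add_of_nonneg_left (Finset.sum_nonneg fun _ _ => by positivity)
    _ ≤ Real.exp (-n) * Real.exp (Real.exp 1 * t) := by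
        gcongr
        exact Real.sum_le_exp_of_nonneg (by positivity) _
    _ = _ := by rw [← Real.exp_add]; ring_nf

theorem sum_choose_mul_two_pow_le {N : ℕ} (hN : 0 < N) (n : ℕ) :
    ∑ k ∈ Finset.range n, (N.choose k : ℝ) * 2 ^ k ≤ n * (2 * N) ^ n := by
  have hN' : (1 : ℝ) ≤ N := by exact_mod_cast hN
  calc _ ≤ ∑ k ∈ Finset.range n, (2 * (N : ℝ)) ^ n := by
        refine Finset.sum_le_sum fun k hk => ?_
        calc (N.choose k : ℝ) * 2 ^ k ≤ (N : ℝ) ^ k * 2 ^ k := by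
              gcongr
              exact_mod_cast Nat.choose_le_pow N k
          _ = (2 * (N : ℝ)) ^ k := by rw [← mul_pow, mul_comm]
          _ ≤ _ := pow_le_pow_right₀ (by linarith) (Finset.mem_range.mp hk).le
    _ = _ := by simp

/-! ### Extrapolation of the Fourier transform from a ball -/

section Propagation

variable {V : Type*} [NormedAddCommGroup V] [InnerProductSpace ℝ V] [MeasurableSpace V]
  [BorelSpace V] [FiniteDimensional ℝ V]

/-- The integral is a k-th finite difference of 𝓕v with step y; its binomial weights have absolute
sum 2^k. -/
theorem norm_integral_finiteDifference_le {v : V → ℂ} (hv : Integrable v) {δ : ℝ} (ξ y : V) (k : ℕ)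
    (h : ∀ j ≤ k, ‖𝓕 v (ξ + (j : ℝ) • y)‖ ≤ δ) :
    ‖∫ x, (Complex.exp (-2 * Real.pi * (inner ℝ x y : ℝ) * Complex.I) - 1) ^ k *
        (Complex.exp (-2 * Real.pi * (inner ℝ x ξ : ℝ) * Complex.I) * v x)‖ ≤ 2 ^ k * δ := by
  have hF : ∀ j : ℕ, 𝓕 v (ξ + (j : ℝ) • y) = ∫ x,
      Complex.exp (-2 * Real.pi * (inner ℝ x y : ℝ) * Complex.I) ^ j *
        (Complex.exp (-2 * Real.pi * (inner ℝ x ξ : ℝ) * Complex.I) * v x) := fun j => by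
    rw [Real.fourier_eq']
    refine integral_congr_ae (.of_forall fun x => ?_)
    simp only [smul_eq_mul]
    rw [← mul_assoc, ← Complex.exp_nat_mul, ← Complex.exp_add, inner_add_right, inner_smul_right]
    congr 2
    push_cast
    ring
  have hint : ∀ j : ℕ, Integrable fun x =>
      Complex.exp (-2 * Real.pi * (inner ℝ x y : ℝ) * Complex.I) ^ j *
        (Complex.exp (-2 * Real.pi * (inner ℝ x ξ : ℝ) * Complex.I) * v x) := fun j => by
    have : ∀ x : V, ‖Complex.exp (-2 * Real.pi * (inner ℝ x y : ℝ) * Complex.I) ^ j *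
        Complex.exp (-2 * Real.pi * (inner ℝ x ξ : ℝ) * Complex.I)‖ ≤ 1 := fun x => by
      have e : ∀ s : ℝ, (-2 * Real.pi * s * Complex.I : ℂ) = ((-2 * Real.pi * s : ℝ) : ℂ) * Complex.I := by
        intro s; push_cast; ring
      rw [norm_mul, norm_pow, e, e, Complex.norm_exp_ofReal_mul_I, Complex.norm_exp_ofReal_mul_I]
      simp
    have hb := hv.bdd_mul (c := 1) (f := fun x : V =>
        Complex.exp (-2 * Real.pi * (inner ℝ x y : ℝ) * Complex.I) ^ j *
          Complex.exp (-2 * Real.pi * (inner ℝ x ξ : ℝ) * Complex.I))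
      (Continuous.aestronglyMeasurable (by fun_prop)) (.of_forall this)
    simpa only [mul_assoc] using hb
  have hsum : (∫ x, (Complex.exp (-2 * Real.pi * (inner ℝ x y : ℝ) * Complex.I) - 1) ^ k *
        (Complex.exp (-2 * Real.pi * (inner ℝ x ξ : ℝ) * Complex.I) * v x)) =
      ∑ j ∈ Finset.range (k + 1), ((-1) ^ (k - j) * (k.choose j : ℂ)) * 𝓕 v (ξ + (j : ℝ) • y) := by
    simp_rw [hF, ← integral_const_mul]
    rw [← integral_finsetSum _ fun j _ => (hint j).const_mul _]
    refine integral_congr_ae (.of_forall fun x => ?_)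
    simp only
    rw [sub_eq_add_neg, add_pow, Finset.sum_mul]
    exact Finset.sum_congr rfl fun j _ => by ring
  rw [hsum]
  calc _ ≤ ∑ j ∈ Finset.range (k + 1), (k.choose j : ℝ) * δ := by
        refine norm_sum_le_of_le _ fun j hj => ?_
        rw [norm_mul, norm_mul, norm_pow, norm_neg, norm_one, one_pow, one_mul,
          Complex.norm_natCast]
        gcongr
        exact h j (by simpa [Nat.lt_succ_iff] using hj)
    _ = 2 ^ k * δ := by
        rw [← Finset.sum_mul]
        congr 1
        exact_mod_cast Nat.sum_range_choose k

/-- Smallness of the Fourier transform on a ball propagates to all of space, if the function is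
supported in a ball. -/
theorem norm_fourier_le_of_forall_ball {v : V → ℂ} (hv : Integrable v) {a r δ : ℝ}
    (hr : 0 < r) (hsupp : ∀ᵐ x, a < ‖x‖ → v x = 0) {ξ : V}
    (h : ∀ η ∈ Metric.ball ξ r, ‖𝓕 v η‖ ≤ δ) {n q : ℕ} (hn : 0 < n) (hq : 0 < q) {w : V}
    (hw : ‖w‖ ≤ q * r) :
    ‖𝓕 v (ξ + w)‖ ≤ n * (2 * (n * q : ℕ)) ^ n * δ +
      (∫ x, ‖v x‖) * Real.exp (Real.exp 1 * (2 * Real.pi * a * ‖w‖) - n) := by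
  set N := n * q with hNdef
  have hN : 0 < N := Nat.mul_pos hn hq
  have hN' : (0 : ℝ) < N := by exact_mod_cast hN
  have hn' : (0 : ℝ) < n := by exact_mod_cast hn
  have hq' : (0 : ℝ) < q := by exact_mod_cast hq
  have hδ : 0 ≤ δ := (norm_nonneg _).trans (h ξ (Metric.mem_ball_self hr))
  -- With N = n q and ‖w‖ ≤ q r, the points ξ + j y with j < n stay in the ball of radius r.
  set y : V := (N : ℝ)⁻¹ • w with hy
  set z : V → ℂ := fun x => Complex.exp (-2 * Real.pi * (inner ℝ x y : ℝ) * Complex.I) with hzdef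
  set g : V → ℂ := fun x => Complex.exp (-2 * Real.pi * (inner ℝ x ξ : ℝ) * Complex.I) * v x
    with hgdef
  have e : ∀ s : ℝ, (-2 * Real.pi * s * Complex.I : ℂ) =
      ((-2 * Real.pi * s : ℝ) : ℂ) * Complex.I := by
    intro s; push_cast; ring
  have hznorm : ∀ x, ‖z x‖ = 1 := fun x => by
    simp only [hzdef]; rw [e, Complex.norm_exp_ofReal_mul_I]
  have hgnorm : ∀ x, ‖g x‖ = ‖v x‖ := fun x => by
    simp only [hgdef]; rw [norm_mul, e, Complex.norm_exp_ofReal_mul_I, one_mul]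
  have hzcont : Continuous z := by simp only [hzdef]; fun_prop
  have hgint : Integrable g := by
    refine hv.bdd_mul (c := 1) (Continuous.aestronglyMeasurable (by fun_prop)) (.of_forall fun x => ?_)
    rw [e, Complex.norm_exp_ofReal_mul_I]
  have hFw : 𝓕 v (ξ + w) = ∫ x, z x ^ N * g x := by
    rw [Real.fourier_eq']
    refine integral_congr_ae (.of_forall fun x => ?_)
    simp only [smul_eq_mul, hzdef, hgdef]
    rw [← mul_assoc, ← Complex.exp_nat_mul, ← Complex.exp_add, inner_add_right, hy,
      inner_smul_right]
    congr 2
    have : (N : ℂ) ≠ 0 := by exact_mod_cast hN.ne'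
    push_cast
    field_simp
    ring
  have hintk : ∀ k : ℕ, Integrable fun x => (z x - 1) ^ k * g x := fun k => by
    refine hgint.bdd_mul (c := 2 ^ k) (Continuous.aestronglyMeasurable (by fun_prop))
      (.of_forall fun x => ?_)
    rw [norm_pow]
    gcongr
    calc ‖z x - 1‖ ≤ ‖z x‖ + ‖(1 : ℂ)‖ := norm_sub_le _ _
      _ = 2 := by rw [hznorm, norm_one]; norm_num
  have hintN : Integrable fun x => z x ^ N * g x :=
    hgint.bdd_mul (c := 1) (Continuous.aestronglyMeasurable (by fun_prop))
      (.of_forall fun x => by rw [norm_pow, hznorm, one_pow])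
  have hintS : Integrable fun x => (∑ k ∈ Finset.range n, (N.choose k : ℂ) * (z x - 1) ^ k) * g x := by
    simp_rw [Finset.sum_mul, mul_assoc]
    exact integrable_finsetSum _ fun k _ => (hintk k).const_mul _
  have hsplit : 𝓕 v (ξ + w) =
      ∑ k ∈ Finset.range n, (N.choose k : ℂ) * (∫ x, (z x - 1) ^ k * g x) +
      ∫ x, (z x ^ N - ∑ k ∈ Finset.range n, (N.choose k : ℂ) * (z x - 1) ^ k) * g x := by
    simp_rw [sub_mul]
    rw [integral_sub hintN hintS, hFw]
    have : (∫ x, (∑ k ∈ Finset.range n, (N.choose k : ℂ) * (z x - 1) ^ k) * g x) =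
        ∑ k ∈ Finset.range n, (N.choose k : ℂ) * (∫ x, (z x - 1) ^ k * g x) := by
      simp_rw [Finset.sum_mul, mul_assoc, ← integral_const_mul]
      exact integral_finsetSum _ fun k _ => (hintk k).const_mul _
    rw [this]; ring
  rw [hsplit]
  refine (norm_add_le _ _).trans (add_le_add ?_ ?_)
  · calc _ ≤ ∑ k ∈ Finset.range n, ((N.choose k : ℝ) * 2 ^ k) * δ := by
          refine norm_sum_le_of_le _ fun k hk => ?_
          rw [norm_mul, Complex.norm_natCast, mul_assoc]
          gcongr
          refine norm_integral_finiteDifference_le hv ξ y k fun j hj => h _ ?_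
          have hjn : (j : ℝ) < n := by exact_mod_cast hj.trans_lt (Finset.mem_range.mp hk)
          rw [Metric.mem_ball, dist_eq_norm, add_sub_cancel_left, hy, smul_smul, norm_smul,
            norm_mul, norm_inv, Real.norm_natCast, Real.norm_natCast]
          calc (j : ℝ) * (N : ℝ)⁻¹ * ‖w‖ ≤ (j : ℝ) * (N : ℝ)⁻¹ * (q * r) := by gcongr
            _ = (j / n) * r := by rw [hNdef]; push_cast; field_simp
            _ < 1 * r := by
              gcongr
              rwa [div_lt_one hn']
            _ = r := one_mul r
      _ ≤ n * (2 * N) ^ n * δ := by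
          rw [← Finset.sum_mul]
          gcongr
          exact sum_choose_mul_two_pow_le hN n
  · rw [mul_comm, ← integral_const_mul]
    refine norm_integral_le_of_norm_le (hv.norm.const_mul _) ?_
    filter_upwards [hsupp] with x hx
    rw [norm_mul, hgnorm]
    rcases lt_or_ge a ‖x‖ with hax | hax
    · simp [hx hax]
    gcongr
    refine norm_pow_sub_sum_choose_le (z x) hN n ?_
    simp only [hzdef]
    rw [e]
    -- On the support ‖z - 1‖ ≤ 2π|x·y| ≤ 2πa‖w‖/N, which is the truncation hypothesis with t =
    -- 2πa‖w‖.
    have h1 := Real.norm_exp_I_mul_ofReal_sub_one_le (x := -2 * Real.pi * inner ℝ x y)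
    rw [mul_comm Complex.I] at h1
    refine h1.trans ?_
    rw [hy, inner_smul_right, norm_mul, norm_mul, norm_mul, norm_neg, norm_inv,
      Real.norm_natCast, Real.norm_of_nonneg Real.pi_pos.le, Real.norm_ofNat]
    have h2 : ‖(inner ℝ x w : ℝ)‖ ≤ a * ‖w‖ := (norm_inner_le_norm x w).trans (by gcongr)
    calc 2 * Real.pi * ((N : ℝ)⁻¹ * ‖(inner ℝ x w : ℝ)‖)
        ≤ 2 * Real.pi * ((N : ℝ)⁻¹ * (a * ‖w‖)) := by gcongr
      _ = _ := by field_simp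

end Propagation

/-! ### Plancherel and distributional derivatives -/

section L2

variable {V : Type*} [NormedAddCommGroup V] [InnerProductSpace ℝ V] [MeasurableSpace V]
  [BorelSpace V] [FiniteDimensional ℝ V]

theorem continuous_fourier {v : V → ℂ} (hv : Integrable v) : Continuous (𝓕 v) :=
  VectorFourier.fourierIntegral_continuous Real.continuous_fourierChar continuous_inner hv

theorem norm_fourier_le {v : V → ℂ} (ξ : V) : ‖𝓕 v ξ‖ ≤ ∫ x, ‖v x‖ :=
  VectorFourier.norm_fourierIntegral_le_integral_norm _ _ _ _ _

/-- Compactly supported smooth functions are Schwartz and already separate locally integrable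
functions. This identifies L² Fourier transforms with pointwise formulas. -/
theorem ae_eq_of_forall_schwartz {f g : V → ℂ} (hf : LocallyIntegrable f)
    (hg : LocallyIntegrable g) (h : ∀ ψ : 𝓢(V, ℂ), ∫ x, ψ x • f x = ∫ x, ψ x • g x) :
    f =ᵐ[volume] g := by
  refine ae_eq_of_integral_contDiff_smul_eq hf hg fun ψ hψ hψc => ?_
  have h1 : HasCompactSupport (Complex.ofRealCLM ∘ ψ) := hψc.comp_left rfl
  have h2 : ContDiff ℝ ((⊤ : ℕ∞) : WithTop ℕ∞) (Complex.ofRealCLM ∘ ψ) := by fun_prop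
  simpa using h (h1.toSchwartzMap h2)

/-- The `L²` Fourier transform of an integrable `L²` function is given by the Fourier integral. -/
theorem coeFn_fourier_toLp {v : V → ℂ} (hv : Integrable v) (hv2 : MemLp v 2) :
    (𝓕 (hv2.toLp v) : Lp ℂ 2 (volume : Measure V)) =ᵐ[volume] 𝓕 v := by
  refine ae_eq_of_forall_schwartz ((Lp.memLp _).locallyIntegrable one_le_two)
    (continuous_fourier hv).locallyIntegrable fun ψ => ?_
  rw [← Lp.toTemperedDistribution_apply, ← Lp.fourier_toTemperedDistribution_eq,
    TemperedDistribution.fourier_apply, Lp.toTemperedDistribution_apply]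
  calc _ = ∫ x, (𝓕 ψ) x • v x := by
        refine integral_congr_ae ?_
        filter_upwards [hv2.coeFn_toLp] with x hx
        rw [hx]
    _ = _ := by
        rw [SchwartzMap.fourier_coe]
        exact VectorFourier.integral_fourierIntegral_smul_eq_flip (L := innerₗ V)
          Real.continuous_fourierChar continuous_inner ψ.integrable hv |>.trans
          (by rw [flip_innerₗ]; rfl)

theorem fourier_iterate_lineDerivOp (T : 𝓢'(V, ℂ)) (y : V) (m : ℕ) :
    𝓕 (∂_{y}^[m] T) = (2 * Real.pi * Complex.I) ^ m •
      smulLeftCLM ℂ (fun ξ : V => ((inner ℝ ξ y : ℝ) : ℂ) ^ m) (𝓕 T) := by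
  have hg : (fun ξ : V => ((inner ℝ ξ y : ℝ) : ℂ)).HasTemperateGrowth := by fun_prop
  have hgm (m : ℕ) : (fun ξ : V => ((inner ℝ ξ y : ℝ) : ℂ) ^ m).HasTemperateGrowth := hg.pow m
  induction m with
  | zero => simp
  | succ m ih =>
    rw [Function.iterate_succ_apply', fourier_lineDerivOp_eq, ih, map_smul, smul_smul,
      smulLeftCLM_smulLeftCLM_apply (hgm m) hg, ← pow_succ']
    rfl

theorem coeFn_fourier_of_iterate_lineDerivOp {v : V → ℂ} (hv : Integrable v) (hv2 : MemLp v 2)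
    {y : V} {m : ℕ} {g : Lp ℂ 2 (volume : Measure V)}
    (h : ∂_{y}^[m] ((hv2.toLp v : Lp ℂ 2 (volume : Measure V)) : 𝓢'(V, ℂ)) = (g : 𝓢'(V, ℂ))) :
    (𝓕 g : Lp ℂ 2 (volume : Measure V)) =ᵐ[volume]
      fun ξ => (2 * Real.pi * Complex.I * (inner ℝ ξ y : ℝ)) ^ m * 𝓕 v ξ := by
  have hc := continuous_fourier hv
  have hg : (fun ξ : V => ((inner ℝ ξ y : ℝ) : ℂ) ^ m).HasTemperateGrowth :=
    Function.HasTemperateGrowth.pow (by fun_prop) m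
  refine ae_eq_of_forall_schwartz ((Lp.memLp _).locallyIntegrable one_le_two)
    (Continuous.locallyIntegrable (by fun_prop)) fun ψ => ?_
  rw [← Lp.toTemperedDistribution_apply, ← Lp.fourier_toTemperedDistribution_eq, ← h,
    fourier_iterate_lineDerivOp, Lp.fourier_toTemperedDistribution_eq]
  rw [smul_apply, smulLeftCLM_apply_apply, Lp.toTemperedDistribution_apply,
    ← integral_smul]
  refine integral_congr_ae ?_
  filter_upwards [coeFn_fourier_toLp hv hv2] with x hx
  rw [hx, SchwartzMap.smulLeftCLM_apply_apply hg]
  simp only [smul_eq_mul, mul_pow]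
  ring

theorem eLpNorm_fourier {v : V → ℂ} (hv : Integrable v) (hv2 : MemLp v 2) :
    eLpNorm (𝓕 v) 2 volume = eLpNorm v 2 volume := by
  rw [← eLpNorm_congr_ae (coeFn_fourier_toLp hv hv2), ← Lp.enorm_def, ← Lp.enorm_toLp hv2,
    ← ofReal_norm, ← ofReal_norm, Lp.norm_fourier_eq]

end L2

/-! ### Low and high frequencies -/

theorem eLpNorm_mul_fourier_le {d m : ℕ} {v : Space d → ℂ} (hv : Integrable v) (hv2 : MemLp v 2)
    {γ : ℝ}
    (h : sobolevSeminorm m ((hv2.toLp v : Lp ℂ 2 (volume : Measure (Space d))) : 𝓢'(Space d, ℂ))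
      ≤ ENNReal.ofReal γ) (j : Fin d) :
    eLpNorm (fun ξ : Space d => ((2 * Real.pi * ξ j) ^ m : ℝ) • 𝓕 v ξ) 2 volume ≤
      ENNReal.ofReal γ := by
  set T : 𝓢'(Space d, ℂ) := ((hv2.toLp v : Lp ℂ 2 (volume : Measure (Space d))) : 𝓢'(Space d, ℂ))
  set y : Space d := EuclideanSpace.single j (1 : ℝ)
  have h1 : l2Norm (∂^{fun _ : Fin m => y} T) ≤ ENNReal.ofReal γ := by
    refine le_trans ?_ h
    rw [sobolevSeminorm]
    calc _ = (l2Norm (∂^{fun _ : Fin m => y} T) ^ 2) ^ (1 / 2 : ℝ) := by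
          rw [← ENNReal.rpow_natCast, ← ENNReal.rpow_mul]; norm_num
      _ ≤ _ := by
          refine ENNReal.rpow_le_rpow ?_ (by norm_num)
          exact Finset.single_le_sum (f := fun j : Fin d =>
            l2Norm (∂^{fun _ : Fin m => (EuclideanSpace.single j (1 : ℝ) : Space d)} T) ^ 2)
            (fun _ _ => zero_le) (Finset.mem_univ j)
  obtain ⟨g, hg⟩ : ∃ g : Lp ℂ 2 (volume : Measure (Space d)),
      ∂^{fun _ : Fin m => y} T = (g : 𝓢'(Space d, ℂ)) := by
    -- Without an L² representative the infimum in `l2Norm` is over an empty family, hence infinite.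
    by_contra! hne
    have : l2Norm (∂^{fun _ : Fin m => y} T) = ∞ := by
      rw [l2Norm, iInf₂_eq_top]
      exact fun g hg => absurd hg (hne g)
    rw [this] at h1
    exact absurd h1 (not_le.mpr ENNReal.ofReal_lt_top)
  rw [hg, l2Norm_coe] at h1
  rw [LineDeriv.iteratedLineDerivOp_const_eq_iter_lineDerivOp] at hg
  refine le_trans (le_of_eq ?_) h1
  rw [← ofReal_norm g, ← Lp.norm_fourier_eq g, ofReal_norm, Lp.enorm_def]
  refine eLpNorm_congr_norm_ae ?_
  filter_upwards [coeFn_fourier_of_iterate_lineDerivOp hv hv2 hg] with ξ hξ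
  rw [hξ, norm_smul, norm_mul, norm_pow, norm_pow]
  simp [y, EuclideanSpace.inner_single_right]

theorem toReal_eLpNorm_two_sq {α : Type*} [MeasurableSpace α] {ν : Measure α} {f : α → ℂ}
    (hf : MemLp f 2 ν) : (eLpNorm f 2 ν).toReal ^ 2 = ∫ x, ‖f x‖ ^ 2 ∂ν := by
  have h := hf.eLpNorm_eq_integral_rpow_norm two_ne_zero ENNReal.ofNat_ne_top
  have h0 : 0 ≤ ∫ x, ‖f x‖ ^ 2 ∂ν := integral_nonneg fun _ => by positivity
  simp only [ENNReal.toReal_ofNat, Real.rpow_ofNat] at h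
  rw [h, ENNReal.toReal_ofReal (by positivity), ← Real.rpow_natCast, ← Real.rpow_mul h0]
  norm_num

theorem integrable_norm_sq {α : Type*} [MeasurableSpace α] {ν : Measure α} {f : α → ℂ}
    (hf : MemLp f 2 ν) : Integrable (fun x => ‖f x‖ ^ 2) ν := by
  simpa using hf.integrable_norm_pow two_ne_zero

theorem exists_norm_sq_le_card_mul_sq {d : ℕ} (hd : 1 ≤ d) (ξ : Space d) :
    ∃ j, ‖ξ‖ ^ 2 ≤ d * ξ j ^ 2 := by
  by_contra! h
  have : Nonempty (Fin d) := ⟨⟨0, hd⟩⟩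
  have h1 : ∑ j, (d * ξ j ^ 2) < ∑ _j : Fin d, ‖ξ‖ ^ 2 :=
    Finset.sum_lt_sum_of_nonempty Finset.univ_nonempty fun j _ => h j
  rw [← Finset.mul_sum, ← EuclideanSpace.real_norm_sq_eq] at h1
  simp at h1

/-- Frequencies of norm at least `ρ` are controlled by the Sobolev seminorm. -/
theorem eLpNorm_sq_le_of_norm_fourier_le {d m : ℕ} (hd : 1 ≤ d) {v : Space d → ℂ}
    (hv : Integrable v) (hv2 : MemLp v 2) {γ : ℝ} (hγ : 0 ≤ γ)
    (h : sobolevSeminorm m ((hv2.toLp v : Lp ℂ 2 (volume : Measure (Space d))) : 𝓢'(Space d, ℂ))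
      ≤ ENNReal.ofReal γ) {ρ S : ℝ} (hρ : 0 < ρ)
    (hS : ∀ ξ : Space d, ‖ξ‖ ≤ ρ → ‖𝓕 v ξ‖ ≤ S) :
    (eLpNorm v 2 volume).toReal ^ 2 ≤
      S ^ 2 * (ρ ^ d * volume.real (Metric.ball (0 : Space d) 1)) +
        (d / ρ ^ 2) ^ m * (d * γ ^ 2) := by
  have hc := continuous_fourier hv
  have hu : MemLp (𝓕 v) 2 volume :=
    ⟨hc.aestronglyMeasurable, by rw [eLpNorm_fourier hv hv2]; exact hv2.2⟩
  set f : Fin d → Space d → ℂ := fun j ξ => ((2 * Real.pi * ξ j) ^ m : ℝ) • 𝓕 v ξ with hf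
  have hfm : ∀ j, MemLp (f j) 2 volume := fun j =>
    ⟨Continuous.aestronglyMeasurable (by simp only [hf]; fun_prop),
      (eLpNorm_mul_fourier_le hv hv2 h j).trans_lt ENNReal.ofReal_lt_top⟩
  have hfγ : ∀ j, ∫ ξ, ‖f j ξ‖ ^ 2 ≤ γ ^ 2 := fun j => by
    rw [← toReal_eLpNorm_two_sq (hfm j)]
    gcongr
    exact ENNReal.toReal_le_of_le_ofReal hγ (eLpNorm_mul_fourier_le hv hv2 h j)
  have hd' : (0 : ℝ) < d := by exact_mod_cast hd
  rw [← eLpNorm_fourier hv hv2, toReal_eLpNorm_two_sq hu,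
    ← integral_add_compl (Metric.isClosed_closedBall (x := (0 : Space d)) (ε := ρ)).measurableSet
      (integrable_norm_sq hu)]
  refine add_le_add ?_ ?_
  · have hvol : volume.real (Metric.closedBall (0 : Space d) ρ) =
        ρ ^ d * volume.real (Metric.ball (0 : Space d) 1) := by
      rw [Measure.real, Measure.addHaar_closedBall _ _ hρ.le, ENNReal.toReal_mul,
        ENNReal.toReal_ofReal (by positivity), finrank_euclideanSpace_fin, Measure.real]
    rw [← hvol]
    refine (le_abs_self _).trans (norm_setIntegral_le_of_norm_le_const (μ := volume)
      (f := fun ξ => ‖𝓕 v ξ‖ ^ 2) (measure_closedBall_lt_top) fun ξ hξ => ?_)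
    rw [norm_pow, norm_norm]
    gcongr
    exact hS ξ (by simpa using hξ)
  · have hint : Integrable fun ξ => (d / ρ ^ 2) ^ m * ∑ j, ‖f j ξ‖ ^ 2 :=
      (integrable_finsetSum _ fun j _ => integrable_norm_sq (hfm j)).const_mul _
    calc ∫ ξ in (Metric.closedBall (0 : Space d) ρ)ᶜ, ‖𝓕 v ξ‖ ^ 2
        ≤ ∫ ξ in (Metric.closedBall (0 : Space d) ρ)ᶜ, (d / ρ ^ 2) ^ m * ∑ j, ‖f j ξ‖ ^ 2 := by
          refine setIntegral_mono_on (integrable_norm_sq hu).integrableOn hint.integrableOn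
            Metric.isClosed_closedBall.measurableSet.compl fun ξ hξ => ?_
          have hξ' : ρ < ‖ξ‖ := by simpa using hξ
          obtain ⟨j, hj⟩ := exists_norm_sq_le_card_mul_sq hd ξ
          -- Some coordinate carries at least the fraction 1/d of ‖ξ‖² > ρ², so its m-th power
          -- weight dominates 1 outside the ball.
          have h1 : 1 ≤ (d / ρ ^ 2) * (2 * Real.pi * ξ j) ^ 2 := by
            rw [div_mul_eq_mul_div, one_le_div (by positivity)]
            have h2 : ρ ^ 2 ≤ ‖ξ‖ ^ 2 := by gcongr
            have h3 : 1 ≤ (2 * Real.pi) ^ 2 := one_le_pow₀ (by linarith [Real.pi_gt_three])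
            rw [mul_pow]
            nlinarith [mul_nonneg hd'.le (sq_nonneg (ξ j))]
          calc ‖𝓕 v ξ‖ ^ 2 ≤ ((d / ρ ^ 2) * (2 * Real.pi * ξ j) ^ 2) ^ m * ‖𝓕 v ξ‖ ^ 2 :=
                le_mul_of_one_le_left (by positivity) (one_le_pow₀ h1)
            _ = (d / ρ ^ 2) ^ m * ‖f j ξ‖ ^ 2 := by
                simp only [hf]
                rw [norm_smul, norm_pow, mul_pow, mul_pow (‖_‖ ^ m), pow_right_comm (‖_‖) m 2,
                  Real.norm_eq_abs, sq_abs, mul_assoc]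
            _ ≤ _ := by
                gcongr
                exact Finset.single_le_sum (f := fun j => ‖f j ξ‖ ^ 2)
                  (fun _ _ => by positivity) (Finset.mem_univ j)
      _ ≤ ∫ ξ, (d / ρ ^ 2) ^ m * ∑ j, ‖f j ξ‖ ^ 2 :=
          setIntegral_le_integral hint (.of_forall fun ξ => by
            simp only [Pi.zero_apply]; positivity)
      _ ≤ (d / ρ ^ 2) ^ m * (d * γ ^ 2) := by
          rw [integral_const_mul, integral_finsetSum _ fun j _ => integrable_norm_sq (hfm j)]
          gcongr
          calc _ ≤ ∑ _j : Fin d, γ ^ 2 := Finset.sum_le_sum fun j _ => hfγ j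
            _ = _ := by simp

/-! ### Compact support and Poincaré's inequality -/

section Support

variable {V : Type*} [NormedAddCommGroup V] [InnerProductSpace ℝ V] [MeasurableSpace V]
  [BorelSpace V] [FiniteDimensional ℝ V]

theorem eLpNorm_one_le_of_support {v : V → ℂ} (hv2 : MemLp v 2) {a : ℝ}
    (hsupp : ∀ᵐ x, a < ‖x‖ → v x = 0) :
    eLpNorm v 1 volume ≤
      eLpNorm v 2 volume * volume (Metric.closedBall (0 : V) a) ^ (1 / 2 : ℝ) := by
  have hs : MeasurableSet (Metric.closedBall (0 : V) a) :=
    Metric.isClosed_closedBall.measurableSet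
  have hind : v =ᵐ[volume] (Metric.closedBall (0 : V) a).indicator v := by
    filter_upwards [hsupp] with x hx
    by_cases hxa : x ∈ Metric.closedBall (0 : V) a
    · rw [Set.indicator_of_mem hxa]
    · rw [Set.indicator_of_notMem hxa, hx (by simpa using hxa)]
  rw [eLpNorm_congr_ae hind, eLpNorm_indicator_eq_eLpNorm_restrict hs]
  refine (eLpNorm_le_eLpNorm_mul_rpow_measure_univ one_le_two
    hv2.aestronglyMeasurable.restrict).trans ?_
  refine mul_le_mul' (eLpNorm_mono_measure _ Measure.restrict_le_self) (le_of_eq ?_)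
  rw [Measure.restrict_apply_univ]
  norm_num

theorem integrable_of_support {v : V → ℂ} (hv2 : MemLp v 2) {a : ℝ}
    (hsupp : ∀ᵐ x, a < ‖x‖ → v x = 0) : Integrable v := by
  rw [← memLp_one_iff_integrable]
  refine ⟨hv2.1, (eLpNorm_one_le_of_support hv2 hsupp).trans_lt ?_⟩
  exact ENNReal.mul_lt_top hv2.2
    (ENNReal.rpow_lt_top_of_nonneg (by norm_num) measure_closedBall_lt_top.ne)

theorem integral_norm_le_of_support {v : V → ℂ} (hv2 : MemLp v 2) {a : ℝ}
    (hsupp : ∀ᵐ x, a < ‖x‖ → v x = 0) :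
    ∫ x, ‖v x‖ ≤
      (eLpNorm v 2 volume).toReal * volume.real (Metric.closedBall (0 : V) a) ^ (1 / 2 : ℝ) := by
  rw [integral_norm_eq_lintegral_enorm hv2.1, ← eLpNorm_one_eq_lintegral_enorm, Measure.real,
    ENNReal.toReal_rpow, ← ENNReal.toReal_mul]
  exact ENNReal.toReal_mono (ENNReal.mul_ne_top hv2.2.ne
    (ENNReal.rpow_lt_top_of_nonneg (by norm_num) measure_closedBall_lt_top.ne).ne)
    (eLpNorm_one_le_of_support hv2 hsupp)

end Support

/-- Poincaré's inequality for functions supported in a fixed ball. -/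
theorem exists_eLpNorm_le {d : ℕ} (hd : 1 ≤ d) (m : ℕ) (a : ℝ) {γ : ℝ} (hγ : 0 ≤ γ) :
    ∃ K : ℝ, 0 < K ∧ ∀ (v : Space d → ℂ) (hv2 : MemLp v 2), (∀ᵐ x, a < ‖x‖ → v x = 0) →
      sobolevSeminorm m ((hv2.toLp v : Lp ℂ 2 (volume : Measure (Space d))) : 𝓢'(Space d, ℂ))
        ≤ ENNReal.ofReal γ →
      (eLpNorm v 2 volume).toReal ≤ K := by
  set s := volume.real (Metric.closedBall (0 : Space d) a) ^ (1 / 2 : ℝ) with hs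
  set ω := volume.real (Metric.ball (0 : Space d) 1) with hω
  have hω0 : 0 ≤ ω := measureReal_nonneg
  -- Since |𝓕v| ≤ ‖v‖₁ ≤ s‖v‖₂, the low-frequency part is at most s²ωρ^d ‖v‖₂². This ρ makes the
  -- factor at most 1/2, so the term is absorbed on the left.
  set ρ : ℝ := 1 / (2 * (s ^ 2 * ω + 1)) with hρdef
  have hX : 0 ≤ s ^ 2 * ω := by positivity
  have hρ : 0 < ρ := by positivity
  have hρ1 : ρ ≤ 1 := by
    rw [hρdef, div_le_one (by positivity)]; linarith
  set C : ℝ := (d / ρ ^ 2) ^ m * (d * γ ^ 2) with hC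
  have hC0 : 0 ≤ C := by positivity
  refine ⟨2 * C + 1, by positivity, fun v hv2 hsupp hγv => ?_⟩
  have hv := integrable_of_support hv2 hsupp
  set E := (eLpNorm v 2 volume).toReal
  have h := eLpNorm_sq_le_of_norm_fourier_le hd hv hv2 hγ hγv hρ (S := E * s) fun ξ _ =>
    (norm_fourier_le ξ).trans (integral_norm_le_of_support hv2 hsupp)
  have h1 : (E * s) ^ 2 * (ρ ^ d * ω) ≤ E ^ 2 * (1 / 2) := by
    have h2 : ρ ^ d ≤ ρ := pow_le_of_le_one hρ.le hρ1 (by omega)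
    calc (E * s) ^ 2 * (ρ ^ d * ω) ≤ (E * s) ^ 2 * (ρ * ω) := by gcongr
      _ = E ^ 2 * (ρ * (s ^ 2 * ω)) := by ring
      _ ≤ E ^ 2 * (1 / 2) := by
          gcongr
          rw [hρdef, one_div_mul_eq_div, div_le_div_iff₀ (by positivity) two_pos]
          linarith
  have h3 : E ^ 2 ≤ 2 * C := by linarith
  nlinarith [sq_nonneg (E - 1)]

/-! ### From superexponentially small data to an algebraic rate -/

/-- Superexponential decay of order `β > 1` beats the growth of `n ^ n`. -/
theorem exists_pow_mul_exp_neg_rpow_le (p D : ℕ) {β : ℝ} (hβ : 1 < β) :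
    ∃ K : ℝ, ∀ n : ℕ,
      (n : ℝ) ^ (p + 1) * (2 * (n * (D * n) : ℕ)) ^ n * Real.exp (-((n : ℝ) / 2) ^ β) ≤ K := by
  set F : ℕ → ℝ := fun n =>
    (n : ℝ) ^ (p + 1) * (2 * (n * (D * n) : ℕ)) ^ n * Real.exp (-((n : ℝ) / 2) ^ β) with hF
  suffices h : ∀ᶠ n in Filter.atTop, F n ≤ 1 by
    obtain ⟨K, hK⟩ := (Filter.isBoundedUnder_of_eventually_le h).bddAbove_range
    exact ⟨K, fun n => hK ⟨n, rfl⟩⟩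
  -- For n ≥ 2D the prefactor is at most n^{(p+4)n} = exp((p+4) n log n). The constant is chosen so
  -- that this exponent is at most (n/2)^β.
  have hlog := ((isLittleO_log_rpow_atTop (r := β - 1) (by linarith)).def
    (c := (1 / 2 : ℝ) ^ β / (p + 4)) (by positivity)).natCast_atTop
  filter_upwards [hlog, Filter.eventually_ge_atTop 1, Filter.eventually_ge_atTop (2 * D)]
    with n hn hn1 hnD
  have hn1' : (1 : ℝ) ≤ n := by exact_mod_cast hn1
  have hnD' : (2 * D : ℝ) ≤ n := by exact_mod_cast hnD
  have hn0 : (0 : ℝ) < n := by linarith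
  rw [Real.norm_of_nonneg (Real.log_nonneg hn1'), Real.norm_of_nonneg (by positivity)] at hn
  have h1 : (n : ℝ) ^ (p + 1) * (2 * (n * (D * n) : ℕ)) ^ n ≤ Real.exp (((n : ℝ) / 2) ^ β) := by
    calc (n : ℝ) ^ (p + 1) * (2 * (n * (D * n) : ℕ)) ^ n
        ≤ (n : ℝ) ^ ((p + 1) * n) * ((n : ℝ) ^ 3) ^ n := by
          gcongr ?_ * ?_ ^ n
          · refine pow_le_pow_right₀ hn1' ?_
            exact Nat.le_mul_of_pos_right _ hn1
          · push_cast
            nlinarith [mul_le_mul_of_nonneg_right hnD' (sq_nonneg (n : ℝ))]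
      _ = (n : ℝ) ^ ((p + 4) * n) := by rw [← pow_mul, ← pow_add]; ring_nf
      _ = Real.exp ((p + 4) * n * Real.log n) := by
          rw [← Real.rpow_natCast, Real.rpow_def_of_pos hn0]
          push_cast
          ring_nf
      _ ≤ _ := by
          rw [Real.exp_le_exp]
          calc (p + 4) * n * Real.log n
              ≤ (p + 4) * n * ((1 / 2 : ℝ) ^ β / (p + 4) * (n : ℝ) ^ (β - 1)) := by gcongr
            _ = (1 / 2 : ℝ) ^ β * ((n : ℝ) ^ (β - 1) * n) := by field_simp
            _ = _ := by
                rw [Real.rpow_sub_one hn0.ne', div_mul_cancel₀ _ hn0.ne',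
                  ← Real.mul_rpow (by norm_num) hn0.le]
                congr 1
                ring
  calc F n ≤ Real.exp (((n : ℝ) / 2) ^ β) * Real.exp (-((n : ℝ) / 2) ^ β) := by
        simp only [hF]; gcongr
    _ = 1 := by rw [← Real.exp_add]; simp

theorem pow_mul_exp_neg_half_le (p n : ℕ) :
    (n : ℝ) ^ p * Real.exp (-(n / 2)) ≤ 2 ^ p * p ! := by
  have h := Real.pow_div_factorial_le_exp ((n : ℝ) / 2) (by positivity) p
  rw [div_le_iff₀ (by positivity), div_pow, div_le_iff₀ (by positivity)] at h
  calc (n : ℝ) ^ p * Real.exp (-(n / 2))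
      ≤ (Real.exp (n / 2) * p ! * 2 ^ p) * Real.exp (-(n / 2)) := by gcongr
    _ = 2 ^ p * p ! * (Real.exp (n / 2) * Real.exp (-(n / 2))) := by ring
    _ = _ := by rw [← Real.exp_add]; simp

/-- The weight x^{2m} exactly cancels the decay of the high-frequency term; the additional decay
x^{-d} of S absorbs the volume growth x^d of the ball. -/
theorem sq_pow_mul_le {m d : ℕ} {x l ω E S Q e G : ℝ} (hl : 0 < l) (hω : 0 ≤ ω) (hx : 1 ≤ x)
    (hS : 0 ≤ S) (hSQ : x ^ (m + d) * S ≤ Q)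
    (h : E ^ 2 ≤ S ^ 2 * ((l * x) ^ d * ω) + (e / (l * x) ^ 2) ^ m * G) :
    (x ^ m * E) ^ 2 ≤ Q ^ 2 * (l ^ d * ω) + (e / l ^ 2) ^ m * G := by
  have hx0 : 0 < x := by linarith
  calc (x ^ m * E) ^ 2 = (x ^ m) ^ 2 * E ^ 2 := by ring
    _ ≤ (x ^ m) ^ 2 * (S ^ 2 * ((l * x) ^ d * ω) + (e / (l * x) ^ 2) ^ m * G) := by gcongr
    _ = (x ^ m * S) ^ 2 * x ^ d * (l ^ d * ω) + (x ^ 2 * (e / (l * x) ^ 2)) ^ m * G := by ring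
    _ = (x ^ m * S) ^ 2 * x ^ d * (l ^ d * ω) + (e / l ^ 2) ^ m * G := by
        congr 3
        field_simp
    _ ≤ _ := by
        gcongr
        calc (x ^ m * S) ^ 2 * x ^ d ≤ (x ^ m * S) ^ 2 * (x ^ d) ^ 2 := by
              gcongr
              exact le_self_pow₀ (one_le_pow₀ hx) two_ne_zero
          _ = (x ^ (m + d) * S) ^ 2 := by ring
          _ ≤ Q ^ 2 := by gcongr

/-- Superexponential smallness of the Fourier transform on a ball yields an algebraic rate. -/
theorem exists_eLpNorm_le_div_pow {d : ℕ} (hd : 1 ≤ d) (m : ℕ) {a γ r κ β : ℝ} (ha : 0 < a)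
    (hγ : 0 ≤ γ) (ξ₀ : Space d) (hr : 0 < r) (hκ : 0 ≤ κ) (hβ : 1 < β) :
    ∃ c : ℝ, 0 < c ∧ ∀ (v : Space d → ℂ) (hv2 : MemLp v 2), (∀ᵐ x, a < ‖x‖ → v x = 0) →
      sobolevSeminorm m ((hv2.toLp v : Lp ℂ 2 (volume : Measure (Space d))) : 𝓢'(Space d, ℂ))
        ≤ ENNReal.ofReal γ →
      ∀ n : ℕ, 0 < n →
        (∀ η ∈ Metric.ball ξ₀ r, ‖𝓕 v η‖ ≤ κ * Real.exp (-((n : ℝ) / 2) ^ β)) →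
        (eLpNorm v 2 volume).toReal ≤ c / n ^ m := by
  obtain ⟨K, hK, hKv⟩ := exists_eLpNorm_le hd m a hγ
  set s := volume.real (Metric.closedBall (0 : Space d) a) ^ (1 / 2 : ℝ) with hs
  have hs0 : 0 ≤ s := by positivity
  set ω := volume.real (Metric.ball (0 : Space d) 1) with hω
  have hω0 : 0 ≤ ω := measureReal_nonneg
  set b : ℝ := Real.exp 1 * (2 * Real.pi * a) with hb
  have hb0 : 0 < b := by positivity
  -- Since b l = 1/2, extrapolating to radius l n leaves a remainder of order e^{-n/2}.
  set l : ℝ := 1 / (2 * b) with hl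
  have hl0 : 0 < l := by positivity
  -- Then q = D n satisfies ‖ξ - ξ₀‖ ≤ q r for every ‖ξ‖ ≤ l n with n ≥ 1.
  obtain ⟨D, hD⟩ := exists_nat_gt ((l + ‖ξ₀‖) / r)
  have hD0 : 0 < D := by
    have : (0 : ℝ) < D := lt_of_le_of_lt (by positivity) hD
    exact_mod_cast this
  rw [div_lt_iff₀ hr] at hD
  obtain ⟨K₁, hK₁⟩ := exists_pow_mul_exp_neg_rpow_le (m + d) D hβ
  set Q : ℝ := κ * K₁ + K * s * Real.exp (b * ‖ξ₀‖) * (2 ^ (m + d) * (m + d)!) with hQ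
  set C : ℝ := Q ^ 2 * (l ^ d * ω) + (d / l ^ 2) ^ m * (d * γ ^ 2) with hC
  have hC0 : 0 ≤ C := by positivity
  clear_value C Q l b s ω
  refine ⟨C + 1, by positivity, fun v hv2 hsupp hγv n hn hsmall => ?_⟩
  have hv := integrable_of_support hv2 hsupp
  have hn0 : (0 : ℝ) < n := by exact_mod_cast hn
  have hn1 : (1 : ℝ) ≤ n := by exact_mod_cast hn
  set E := (eLpNorm v 2 volume).toReal with hE
  have hE0 : 0 ≤ E := ENNReal.toReal_nonneg
  set δ := κ * Real.exp (-((n : ℝ) / 2) ^ β) with hδ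
  set S : ℝ := n * (2 * (n * (D * n) : ℕ)) ^ n * δ +
    K * s * (Real.exp (b * ‖ξ₀‖) * Real.exp (-(n / 2))) with hS
  have hS0 : 0 ≤ S := by positivity
  clear_value S δ E
  have hSQ : (n : ℝ) ^ (m + d) * S ≤ Q := by
    calc (n : ℝ) ^ (m + d) * S
        = κ * ((n : ℝ) ^ (m + d + 1) * (2 * (n * (D * n) : ℕ)) ^ n *
            Real.exp (-((n : ℝ) / 2) ^ β)) +
          K * s * Real.exp (b * ‖ξ₀‖) * ((n : ℝ) ^ (m + d) * Real.exp (-(n / 2))) := by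
          rw [hS, hδ]; ring
      _ ≤ Q := by
          rw [hQ]
          exact add_le_add (mul_le_mul_of_nonneg_left (hK₁ n) hκ)
            (mul_le_mul_of_nonneg_left (pow_mul_exp_neg_half_le _ _) (by positivity))
  have hbound : ∀ ξ : Space d, ‖ξ‖ ≤ l * n → ‖𝓕 v ξ‖ ≤ S := fun ξ hξ => by
    have hw : ‖ξ - ξ₀‖ ≤ l * n + ‖ξ₀‖ := (norm_sub_le _ _).trans (by gcongr)
    have hw' : ‖ξ - ξ₀‖ ≤ (D * n : ℕ) * r := by
      push_cast
      calc ‖ξ - ξ₀‖ ≤ l * n + ‖ξ₀‖ * n := hw.trans (by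
            gcongr; exact le_mul_of_one_le_right (norm_nonneg _) hn1)
        _ = (l + ‖ξ₀‖) * n := by ring
        _ ≤ (D * r) * n := by gcongr
        _ = _ := by ring
    have h := norm_fourier_le_of_forall_ball hv hr hsupp hsmall hn (Nat.mul_pos hD0 hn) hw'
    rw [add_sub_cancel] at h
    refine h.trans ?_
    rw [hS]
    gcongr
    · exact (integral_norm_le_of_support hv2 hsupp).trans (by
        rw [← hs]; gcongr; exact hKv v hv2 hsupp hγv)
    · rw [← Real.exp_add, Real.exp_le_exp, ← mul_assoc, ← hb]
      have h1 : b * ‖ξ - ξ₀‖ ≤ b * (l * n + ‖ξ₀‖) := by gcongr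
      have h2 : b * l = 1 / 2 := by rw [hl]; field_simp
      nlinarith
  have h := eLpNorm_sq_le_of_norm_fourier_le hd hv hv2 hγ hγv (by positivity) hbound
  rw [← hE, ← hω] at h
  have h1 : ((n : ℝ) ^ m * E) ^ 2 ≤ C := hC ▸ sq_pow_mul_le hl0 hω0 hn1 hS0 hSQ h
  rw [le_div_iff₀ (by positivity), mul_comm]
  -- Here y ≤ y² + 1 replaces a square root, whence the constant C + 1.
  nlinarith [sq_nonneg ((n : ℝ) ^ m * E - 1)]

/-! ### Normalisation and choice of the extrapolation order -/

theorem fourierTransform_eq {d : ℕ} (v : Space d → ℂ) (ξ : Space d) :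
    fourierTransform v ξ = (((2 * Real.pi) ^ d : ℝ) : ℂ)⁻¹ * 𝓕 v (-(2 * Real.pi)⁻¹ • ξ) := by
  rw [fourierTransform, Real.fourier_eq']
  congr 2
  ext x
  rw [smul_eq_mul, inner_smul_right, real_inner_comm]
  congr 2
  have : (Real.pi : ℂ) ≠ 0 := by exact_mod_cast Real.pi_ne_zero
  push_cast
  field_simp

/-- By continuity the points of B exceeding the essential supremum form an open null set, which is
empty. -/
theorem enorm_le_of_eLpNorm_top_restrict {X : Type*} [TopologicalSpace X] [MeasurableSpace X]
    [OpensMeasurableSpace X] {ν : Measure X} [ν.IsOpenPosMeasure] {f : X → ℂ} (hf : Continuous f)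
    {B : Set X} (hB : IsOpen B) {x : X} (hx : x ∈ B) :
    ‖f x‖ₑ ≤ eLpNorm f ∞ (ν.restrict B) := by
  by_contra! hlt
  have hU : IsOpen (B ∩ {y | eLpNorm f ∞ (ν.restrict B) < ‖f y‖ₑ}) :=
    hB.inter (isOpen_lt continuous_const hf.enorm)
  have h0 : ν (B ∩ {y | eLpNorm f ∞ (ν.restrict B) < ‖f y‖ₑ}) = 0 := by
    have h := ae_le_eLpNormEssSup (f := f) (μ := ν.restrict B)
    rw [← eLpNorm_exponent_top, ae_restrict_iff' hB.measurableSet, ae_iff] at h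
    refine measure_mono_null (fun y hy => ?_) h
    simpa using hy
  rw [hU.measure_eq_zero_iff ν] at h0
  exact (h0.subset ⟨hx, hlt⟩ : x ∈ (∅ : Set X))

/-- The stability estimate in terms of an upper bound `e^{-L}` of the Fourier transform. -/
theorem exists_eLpNorm_le_mul_rpow_neg {d : ℕ} (hd : 1 ≤ d) {A B : Set (Space d)}
    (hA : IsCompact A) (hB : IsOpen B) (hBne : B.Nonempty) (m : ℕ) {γ : ℝ} (hγ : 0 ≤ γ) {μ : ℝ}
    (hμ0 : 0 ≤ μ) (hμm : μ < m) :
    ∃ c : ℝ, 0 < c ∧ ∀ (v : Space d → ℂ) (hv : MemLp v 2), (∀ᵐ x, x ∉ A → v x = 0) →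
      sobolevSeminorm m ((hv.toLp v : Lp ℂ 2 (volume : Measure (Space d))) : 𝓢'(Space d, ℂ))
        ≤ ENNReal.ofReal γ →
      ∀ L : ℝ, 0 < L → fourierSupNorm B v ≤ ENNReal.ofReal (Real.exp (-L)) →
        (eLpNorm v 2 volume).toReal ≤ c * L ^ (-μ) ∧ (eLpNorm v 2 volume).toReal ≤ c := by
  obtain ⟨a, ha, hAa⟩ : ∃ a, 0 < a ∧ A ⊆ Metric.closedBall 0 a := hA.isBounded.subset_closedBall_lt 0 0
  have hsuppA : ∀ v : Space d → ℂ, (∀ᵐ x, x ∉ A → v x = 0) → ∀ᵐ x, a < ‖x‖ → v x = 0 := by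
    intro v hv
    filter_upwards [hv] with x hx hax
    exact hx fun hxA => absurd (hAa hxA) (by simpa using hax)
  obtain ⟨K, hK, hKv⟩ := exists_eLpNorm_le hd m a hγ
  rcases hμ0.eq_or_lt with rfl | hμ
  · refine ⟨K, hK, fun v hv hsupp hγv L hL _ => ?_⟩
    have := hKv v hv (hsuppA v hsupp) hγv
    simpa using this
  obtain ⟨ζ, hζ⟩ := hBne
  obtain ⟨ε, hε, hεB⟩ := Metric.isOpen_iff.mp hB ζ hζ
  have hπ : (0 : ℝ) < 2 * Real.pi := by positivity
  have hm0 : (0 : ℝ) < m := hμ.trans hμm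
  have hβ : 1 < (m : ℝ) / μ := (one_lt_div hμ).mpr hμm
  obtain ⟨c, hc, hcv⟩ := exists_eLpNorm_le_div_pow hd m (a := a) (γ := γ)
    (r := (2 * Real.pi)⁻¹ * ε) (κ := (2 * Real.pi) ^ d) ha hγ (-(2 * Real.pi)⁻¹ • ζ)
    (by positivity) (by positivity) hβ
  refine ⟨max c K, lt_max_of_lt_left hc, fun v hv hsupp hγv L hL hF => ?_⟩
  have hvs := hsuppA v hsupp
  have hKE := hKv v hv hvs hγv
  refine ⟨?_, hKE.trans (le_max_right _ _)⟩
  -- For L ≤ 1 the factor L^{-μ} is at least 1 and the a priori bound suffices.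
  rcases le_total L 1 with hL1 | hL1
  · calc _ ≤ max c K * 1 := by rw [mul_one]; exact hKE.trans (le_max_right _ _)
      _ ≤ max c K * L ^ (-μ) := by
          gcongr
          exact Real.one_le_rpow_of_pos_of_le_one_of_nonpos hL hL1 (by linarith)
  set x : ℝ := L ^ (μ / m) with hx
  have hx1 : 1 ≤ x := Real.one_le_rpow hL1 (by positivity)
  set n := ⌈x⌉₊ with hn
  have hxn : x ≤ n := Nat.le_ceil x
  -- Rounding up at most doubles x because x ≥ 1; this is the source of n/2 in the smallness
  -- hypothesis.
  have hn2 : (n : ℝ) / 2 ≤ x := by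
    have := Nat.ceil_lt_add_one (by linarith : 0 ≤ x)
    linarith
  have hn0 : 0 < n := Nat.ceil_pos.mpr (by linarith)
  have hnL : ((n : ℝ) / 2) ^ ((m : ℝ) / μ) ≤ L := by
    calc ((n : ℝ) / 2) ^ ((m : ℝ) / μ) ≤ x ^ ((m : ℝ) / μ) := by gcongr
      _ = L := by
          rw [hx, ← Real.rpow_mul hL.le]
          have : μ / m * (m / μ) = 1 := by field_simp
          rw [this, Real.rpow_one]
  have hvint := integrable_of_support hv hvs
  have hcont : Continuous (fourierTransform v) := by
    have h1 := continuous_fourier hvint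
    have h2 : fourierTransform v = fun ξ =>
      (((2 * Real.pi) ^ d : ℝ) : ℂ)⁻¹ * 𝓕 v (-(2 * Real.pi)⁻¹ • ξ) := funext (fourierTransform_eq v)
    rw [h2]
    fun_prop
  have hE := hcv v hv hvs hγv n hn0 fun η hη => by
    -- The map η ↦ -2πη carries the ball of radius ε/(2π) around -ζ/(2π) into B.
    have hmem : (-(2 * Real.pi)) • η ∈ B := by
      apply hεB
      rw [Metric.mem_ball, dist_eq_norm] at hη ⊢
      have h1 : (-(2 * Real.pi)) • η - ζ = (-(2 * Real.pi)) • (η - -(2 * Real.pi)⁻¹ • ζ) := by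
        rw [smul_sub, smul_smul]
        congr 1
        rw [neg_mul_neg, mul_inv_cancel₀ hπ.ne', one_smul]
      rw [h1, norm_smul, norm_neg, Real.norm_of_nonneg hπ.le]
      calc _ < 2 * Real.pi * ((2 * Real.pi)⁻¹ * ε) := by gcongr
        _ = ε := by field_simp
    have h2 := (enorm_le_of_eLpNorm_top_restrict (ν := volume) hcont hB hmem).trans hF
    rw [← ofReal_norm, ENNReal.ofReal_le_ofReal_iff (by positivity), fourierTransform_eq,
      smul_smul, neg_mul_neg, inv_mul_cancel₀ hπ.ne', one_smul, norm_mul, norm_inv,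
      Complex.norm_real, Real.norm_of_nonneg (by positivity), inv_mul_le_iff₀ (by positivity)] at h2
    refine h2.trans ?_
    gcongr
  calc _ ≤ c / n ^ m := hE
    _ ≤ max c K / x ^ m := by
        gcongr
        exact le_max_left _ _
    _ = max c K * L ^ (-μ) := by
        rw [Real.rpow_neg hL.le, div_eq_mul_inv, hx, ← Real.rpow_mul_natCast hL.le,
          div_mul_cancel₀ _ hm0.ne']

end FourierStability

/-- Logarithmic stability. The function `v` ranges over the functions in the Sobolev space `H^m`
(with weak derivatives up to order `m` in `L²`) supported in `A` up to a null set.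
If `‖𝓕 v‖_{L^∞(B)} = 0`, then `ln (1 / 0) = ∞`, so the power with exponent `-μ` has to be read
as `0` for `μ > 0` and as `1` for `μ = 0`; these are also the values that `Real.log` and `Real.rpow`
give to the expression below. -/
theorem mainTheorem4 (d : ℕ) (hd : 1 ≤ d)
    (A : Set (FourierStability.Space d)) (hA : IsCompact A)
    (B : Set (FourierStability.Space d)) (hB : IsOpen B) (hBne : B.Nonempty)
    (m : ℕ) (hm : 0 < m) (γ : ℝ) (hγ : 0 < γ)
    (μ : ℝ) (hμ0 : 0 ≤ μ) (hμm : μ < m) :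
    ∃ c : ℝ, 0 < c ∧
      ∀ (v : FourierStability.Space d → ℂ) (hv : MemLp v 2 volume),
        (∀ᵐ x, x ∉ A → v x = 0) →
        MemSobolev (m : ℝ) 2
          ((hv.toLp v : Lp ℂ 2 (volume : Measure (FourierStability.Space d))) :
            𝓢'(FourierStability.Space d, ℂ)) →
        FourierStability.sobolevSeminorm m
          ((hv.toLp v : Lp ℂ 2 (volume : Measure (FourierStability.Space d))) :
            𝓢'(FourierStability.Space d, ℂ)) ≤ ENNReal.ofReal γ →
        FourierStability.fourierSupNorm B v < 1 →
        (eLpNorm v 2 volume).toReal ≤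
          c * (Real.log (1 / (FourierStability.fourierSupNorm B v).toReal)) ^ (-μ) := by
  obtain ⟨c, hc, h⟩ :=
    FourierStability.exists_eLpNorm_le_mul_rpow_neg hd hA hB hBne m hγ.le hμ0 hμm
  refine ⟨c, hc, fun v hv hsupp _ hγv hlt => ?_⟩
  have hv' := h v hv hsupp hγv
  set F := FourierStability.fourierSupNorm B v with hF
  have hFtop : F ≠ ∞ := (hlt.trans ENNReal.one_lt_top).ne
  rcases eq_or_ne F 0 with hF0 | hF0
  · rcases hμ0.eq_or_lt with rfl | hμ
    · simpa using (hv' 1 one_pos (by simp [hF0])).2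
    -- With zero data the estimate holds for every L > 0, so L → ∞ forces ‖v‖ ≤ 0. This matches the
    -- right side, where log(1/0) = 0 and 0^{-μ} = 0.
    · have hlim : Filter.Tendsto (fun L : ℝ => c * L ^ (-μ)) Filter.atTop (nhds (c * 0)) :=
        (tendsto_rpow_neg_atTop hμ).const_mul c
      rw [hF0]
      simp only [ENNReal.toReal_zero, div_zero, Real.log_zero]
      rw [Real.zero_rpow (by linarith)]
      refine ge_of_tendsto hlim ?_
      filter_upwards [Filter.eventually_gt_atTop 0] with L hL
      exact (hv' L hL (by simp [hF0])).1
  · have hpos : 0 < F.toReal := ENNReal.toReal_pos hF0 hFtop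
    have hlt1 : F.toReal < 1 := by
      simpa using (ENNReal.toReal_lt_toReal hFtop ENNReal.one_ne_top).mpr hlt
    refine (hv' _ (Real.log_pos ((one_lt_div hpos).mpr hlt1)) ?_).1
    rw [one_div, Real.log_inv, neg_neg, Real.exp_log hpos, ENNReal.ofReal_toReal hFtop]
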